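/- A weighted graph $\Gamma$ is an undirected graph without loops or multiple edges, in which each edge $xy$ carries a real weight $\omega_{xy}=\omega_{yx}>0$; it is not assumed to be connected. Suppose that $\Gamma$ is locally finite (each vertex has finitely many neighbours), and write $\deg x=\sum_{y\sim x}\omega_{xy}$. Let $\operatorname{Aut}\Gamma$ be the group of graph automorphisms of $\Gamma$ that preserve the weights, and suppose that $\Gamma$ is vertex-transitive, that is, $\operatorname{Aut}\Gamma$ acts transitively on the vertices. Let $e$ be a vertex of $\Gamma$. Let $X_0=e,X_1,X_2,\ldots$ be the random walk on $\Gamma$ started at $e$, which at each step moves from its current position $x$ to a neighbour $y$ of $x$ with probability $\omega_{xy}/\deg x$ (and stays at $x$ if $x$ has no neighbours), and suppose that it is transient, that is, $$\mathbb{P}_e[\,X_n=e\text{ for some }n\ge1\,]<1.$$ Let $K$ be a finitely generated subgroup of $\operatorname{Aut}\Gamma$ such that the orbit $Ke$ is infinite. Then there exists a harmonic function on $\Gamma$ that is not constant on $Ke$; that is, there are a function $h:\Gamma\to\mathbb{R}$ satisfying $$h(x)-\frac1{\deg x}\sum_{y\sim x}\omega_{xy}h(y)=0$$ for every vertex $x$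 of $\Gamma$, and vertices $x,y\in Ke$ with $h(x)\ne h(y)$. -/

import Mathlib

open MeasureTheory ProbabilityTheory

/-- A weighted graph on the vertex set `V`: an undirected simple graph (no loops, no multiple
edges) with a symmetric positive real weight on each edge. The weight function is extended by zero
to pairs of vertices that are not adjacent. -/
structure WeightedGraph (V : Type*) where
  graph : SimpleGraph V
  weight : V → V → ℝ
  weight_symm : ∀ x y, weight x y = weight y x
  weight_pos : ∀ x y, graph.Adj x y → 0 < weight x y
  weight_eq_zero : ∀ x y, ¬ graph.Adj x y → weight x y = 0

namespace WeightedGraph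

variable {V : Type*} (Γ : WeightedGraph V)

/-- The automorphism group: the permutations of the vertices that preserve adjacency and
weights. -/
def aut : Subgroup (Equiv.Perm V) where
  carrier := {g | ∀ x y, (Γ.graph.Adj (g x) (g y) ↔ Γ.graph.Adj x y) ∧
    Γ.weight (g x) (g y) = Γ.weight x y}
  one_mem' := fun _ _ => ⟨Iff.rfl, rfl⟩
  mul_mem' := fun {a b} ha hb x y =>
    ⟨(ha (b x) (b y)).1.trans (hb x y).1, (ha (b x) (b y)).2.trans (hb x y).2⟩
  inv_mem' := fun {a} ha x y => by
    have h := ha (a⁻¹ x) (a⁻¹ y)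
    rw [show a (a⁻¹ x) = x from a.apply_symm_apply x,
      show a (a⁻¹ y) = y from a.apply_symm_apply y] at h
    exact ⟨h.1.symm, h.2.symm⟩

/-- The automorphism group acts transitively on the vertices. -/
def IsVertexTransitive : Prop := ∀ x y : V, ∃ g : Γ.aut, g • x = y

theorem weight_nonneg (x y : V) : 0 ≤ Γ.weight x y := by
  by_cases h : Γ.graph.Adj x y
  · exact (Γ.weight_pos x y h).le
  · exact (Γ.weight_eq_zero x y h).ge

section LocallyFinite

variable [Γ.graph.LocallyFinite]

/-- The degree of a vertex: the total weight of the edges at that vertex. -/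
noncomputable def deg (x : V) : ℝ := ∑ y ∈ Γ.graph.neighborFinset x, Γ.weight x y

/-- The Laplacian. -/
noncomputable def laplacian (f : V → ℝ) (x : V) : ℝ :=
  f x - 1 / Γ.deg x * ∑ y ∈ Γ.graph.neighborFinset x, Γ.weight x y * f y

/-- A function is harmonic if it lies in the kernel of the Laplacian. -/
def IsHarmonic (f : V → ℝ) : Prop := ∀ x, Γ.laplacian f x = 0

theorem deg_pos {x : V} (h : (Γ.graph.neighborFinset x).Nonempty) : 0 < Γ.deg x :=
  Finset.sum_pos (fun y hy => Γ.weight_pos x y ((Γ.graph.mem_neighborFinset x y).1 hy)) h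

theorem sum_step {x : V} (h : (Γ.graph.neighborFinset x).Nonempty) :
    ∑ y ∈ Γ.graph.neighborFinset x, ENNReal.ofReal (Γ.weight x y / Γ.deg x) = 1 := by
  rw [← ENNReal.ofReal_sum_of_nonneg
    (fun y _ => div_nonneg (Γ.weight_nonneg x y) (Γ.deg_pos h).le), ← Finset.sum_div]
  change ENNReal.ofReal (Γ.deg x / Γ.deg x) = 1
  rw [div_self (Γ.deg_pos h).ne', ENNReal.ofReal_one]

open Classical in
/-- The distribution of one step of the random walk from `x`: a neighbour `y` of `x` is chosen
with probability `weight x y / deg x`. At a vertex without neighbours the walk stays where it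
is. -/
noncomputable def step (x : V) : PMF V :=
  if h : (Γ.graph.neighborFinset x).Nonempty then
    PMF.ofFinset (fun y => ENNReal.ofReal (Γ.weight x y / Γ.deg x)) (Γ.graph.neighborFinset x)
      (Γ.sum_step h) (fun y hy => by
        rw [Γ.weight_eq_zero x y (fun h' => hy ((Γ.graph.mem_neighborFinset x y).2 h')), zero_div,
          ENNReal.ofReal_zero])
  else PMF.pure x

section RandomWalk

variable [MeasurableSpace V] [DiscreteMeasurableSpace V]

/-- The transition kernel of the random walk. -/
noncomputable def stepKernel : Kernel V V where
  toFun x := (Γ.step x).toMeasure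
  measurable' := Measurable.of_discrete

instance : IsMarkovKernel Γ.stepKernel :=
  ⟨fun x => PMF.toMeasure.isProbabilityMeasure (Γ.step x)⟩

/-- The conditional law of the position at time `n + 1` given the positions at times `0, …, n`;
it depends on the position at time `n` only. -/
noncomputable def historyKernel (n : ℕ) : Kernel (Finset.Iic n → V) V :=
  Γ.stepKernel.comap (fun ω => ω ⟨n, Finset.mem_Iic.2 le_rfl⟩) (measurable_pi_apply _)

instance (n : ℕ) : IsMarkovKernel (Γ.historyKernel n) := by
  unfold historyKernel
  infer_instance

/-- The law, on the space of trajectories `ℕ → V`, of the random walk started at `x`. -/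
noncomputable def walkLaw (x : V) : Measure (ℕ → V) :=
  Kernel.traj (X := fun _ => V) Γ.historyKernel 0 (fun _ => x)

/-- The vertex `x` is transient: with positive probability, the random walk started at `x` never
returns to `x` at a positive time. -/
def IsTransientAt (x : V) : Prop := Γ.walkLaw x {ω | ∃ n, 0 < n ∧ ω n = x} < 1

end RandomWalk

end LocallyFinite

end WeightedGraph

/-! Suppose every harmonic function is constant on `Ke`, and let `G` be the Green function, finite
by transience. By linear duality, for `x`, `y` in `Ke` the functional `u ↦ u x - u y` is a finite
combination of evaluations of the Laplacian (`exists_finsupp_of_forall_isHarmonic`). Since the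
Laplacian of `G(·, z)` is the indicator of `z`, `G(x, ·)` and `G(y, ·)` differ at only finitely many
points (`finite_green_ne`). Taking `x = s⁻¹e`, `y = e` and using invariance of `G`, the function
`G(e, ·)` is invariant under each generator `s` off a finite set.

On the other hand `G(e, ·)` tends to zero at infinity (`tendsto_green`): return probabilities
dominate the heat kernel and are summable. It is also positive on `Ke`. A low enough superlevel set
in `Ke` is then finite, nonempty and stable under the generators, so it is all of the infinite
orbit, which is absurd (`not_tendsto_of_finite_ne`). -/

open scoped Pointwise in
/-- A positive function on an infinite orbit that tends to zero at infinity cannot be invariant,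
up to finite sets, under each of finitely many generators. -/
theorem not_tendsto_of_finite_ne {G α : Type*} [Group G] [MulAction G α] {S : Set G}
    (hS : S.Finite) {e : α} (he : (MulAction.orbit (Subgroup.closure S) e).Infinite) {f : α → ℝ}
    (hpos : ∀ x ∈ MulAction.orbit (Subgroup.closure S) e, 0 < f x)
    (hne : ∀ s ∈ S, {z | f (s • z) ≠ f z}.Finite) :
    ¬ Filter.Tendsto f Filter.cofinite (nhds 0) := by
  intro hf
  set O := MulAction.orbit (Subgroup.closure S) e with hO
  have hsmul {s : G} (hs : s ∈ Subgroup.closure S) {z : α} (hz : z ∈ O) : s • z ∈ O :=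
    MulAction.mem_orbit_of_mem_orbit (⟨s, hs⟩ : Subgroup.closure S) hz
  have heO : e ∈ O := MulAction.mem_orbit_self e
  have hF : (⋃ s ∈ S, {z | f (s • z) ≠ f z}).Finite := hS.biUnion hne
  -- The level `f m` is low enough that every exceptional point of the orbit lies in the superlevel
  -- set; including `e` makes that set nonempty.
  obtain ⟨m, hm, hmin⟩ := Set.exists_min_image (insert e ((⋃ s ∈ S, {z | f (s • z) ≠ f z}) ∩ O)) f
    ((hF.inter_of_left O).insert e) (Set.insert_nonempty _ _)
  have hmpos : 0 < f m := hpos m (by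
    rcases hm with rfl | hm
    exacts [heO, hm.2])
  have hAfin : {z | z ∈ O ∧ f m ≤ f z}.Finite := by
    refine (Filter.eventually_cofinite.1 (hf.eventually_lt_const hmpos)).subset fun z hz => ?_
    exact not_lt.2 hz.2
  have hstab : Subgroup.closure S ≤ MulAction.stabilizer G {z | z ∈ O ∧ f m ≤ f z} := by
    rw [Subgroup.closure_le]
    intro s hs
    -- For a finite set one inclusion suffices, since a translate has the same cardinality.
    rw [SetLike.mem_coe, MulAction.mem_stabilizer_set_iff_subset_smul_set hAfin]
    intro z hz
    rw [Set.mem_smul_set_iff_inv_smul_mem]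
    have hzO : s⁻¹ • z ∈ O := hsmul (inv_mem (Subgroup.subset_closure hs)) hz.1
    refine ⟨hzO, ?_⟩
    by_contra h
    have h1 : f (s • s⁻¹ • z) = f (s⁻¹ • z) := by
      by_contra h'
      exact h (hmin _ (Set.mem_insert_of_mem _ ⟨Set.mem_biUnion hs h', hzO⟩))
    rw [smul_inv_smul] at h1
    exact h (h1 ▸ hz.2)
  refine he (hAfin.subset ?_)
  rintro _ ⟨g, rfl⟩
  have h1 := MulAction.mem_stabilizer_iff.1 (hstab g.2)
  rw [← h1]
  exact Set.smul_mem_smul_set ⟨heO, hmin e (Set.mem_insert _ _)⟩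

/-! ### Avoidance probabilities, the heat kernel and the last-visit decomposition -/

namespace WeightedGraph

variable {V : Type*} (Γ : WeightedGraph V) [Γ.graph.LocallyFinite]

/-- The average of a function over the neighbours of a vertex, weighted by the transition
probabilities of the random walk. -/
noncomputable def avg (f : V → ℝ) (x : V) : ℝ :=
  ∑ y ∈ Γ.graph.neighborFinset x, Γ.weight x y / Γ.deg x * f y

theorem laplacian_eq (f : V → ℝ) (x : V) : Γ.laplacian f x = f x - Γ.avg f x := by
  rw [laplacian, avg, Finset.mul_sum]
  congr 1
  exact Finset.sum_congr rfl fun y _ => by ring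

theorem deg_nonneg (x : V) : 0 ≤ Γ.deg x :=
  Finset.sum_nonneg fun y _ => Γ.weight_nonneg x y

theorem prob_nonneg (x y : V) : 0 ≤ Γ.weight x y / Γ.deg x :=
  div_nonneg (Γ.weight_nonneg x y) (Γ.deg_nonneg x)

theorem neighborFinset_nonempty {x : V} (h : 0 < Γ.deg x) :
    (Γ.graph.neighborFinset x).Nonempty := by
  by_contra h'
  rw [Finset.not_nonempty_iff_eq_empty] at h'
  simp [deg, h'] at h

theorem sum_prob {x : V} (h : 0 < Γ.deg x) :
    ∑ y ∈ Γ.graph.neighborFinset x, Γ.weight x y / Γ.deg x = 1 := by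
  rw [← Finset.sum_div]
  exact div_self h.ne'

theorem avg_nonneg {f : V → ℝ} (hf : ∀ x, 0 ≤ f x) (x : V) : 0 ≤ Γ.avg f x :=
  Finset.sum_nonneg fun y _ => mul_nonneg (Γ.prob_nonneg x y) (hf y)

theorem avg_const {x : V} (h : 0 < Γ.deg x) (c : ℝ) : Γ.avg (fun _ => c) x = c := by
  rw [avg, ← Finset.sum_mul, Γ.sum_prob h, one_mul]

theorem avg_add (f g : V → ℝ) (x : V) :
    Γ.avg (fun y => f y + g y) x = Γ.avg f x + Γ.avg g x := by
  simp only [avg, mul_add, Finset.sum_add_distrib]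

theorem avg_const_mul (c : ℝ) (f : V → ℝ) (x : V) :
    Γ.avg (fun y => c * f y) x = c * Γ.avg f x := by
  simp only [avg, Finset.mul_sum]
  exact Finset.sum_congr rfl fun y _ => by ring

theorem avg_sum {ι : Type*} (s : Finset ι) (f : ι → V → ℝ) (x : V) :
    Γ.avg (fun y => ∑ i ∈ s, f i y) x = ∑ i ∈ s, Γ.avg (f i) x := by
  simp only [avg, Finset.mul_sum]
  exact Finset.sum_comm

theorem avg_mono {f g : V → ℝ} (h : ∀ y, f y ≤ g y) (x : V) : Γ.avg f x ≤ Γ.avg g x :=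
  Finset.sum_le_sum fun y _ => mul_le_mul_of_nonneg_left (h y) (Γ.prob_nonneg x y)

open Classical in
/-- The probability that the walk started at `x` avoids `e` at the times `1, …, k`. -/
noncomputable def avoid (e : V) : ℕ → V → ℝ
  | 0 => fun _ => 1
  | k + 1 => Γ.avg fun y => if y = e then 0 else avoid e k y

theorem avoid_nonneg (e : V) (k : ℕ) (x : V) : 0 ≤ Γ.avoid e k x := by
  induction k generalizing x with
  | zero => exact zero_le_one
  | succ k ih =>
    refine Γ.avg_nonneg (fun y => ?_) x
    split_ifs
    exacts [le_rfl, ih y]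

open Classical in
/-- The probability that the walk started at `x` is at `z` at time `n`. -/
noncomputable def heat : ℕ → V → V → ℝ
  | 0 => fun x z => if x = z then 1 else 0
  | n + 1 => fun x z => Γ.avg (fun y => heat n y z) x

theorem heat_nonneg (n : ℕ) (x z : V) : 0 ≤ Γ.heat n x z := by
  induction n generalizing x with
  | zero => simp only [heat]; split_ifs <;> norm_num
  | succ n ih => exact Γ.avg_nonneg ih x

/-- Decomposition of the trajectories of length `N` according to the last visit to `e`. -/
theorem avoid_add_sum_heat (hd : ∀ x, 0 < Γ.deg x) (e : V) (N : ℕ) (x : V) :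
    Γ.avoid e N x + ∑ j ∈ Finset.range N, Γ.avoid e (N - (j + 1)) e * Γ.heat (j + 1) x e = 1 := by
  induction N generalizing x with
  | zero => simp [avoid]
  | succ N ih =>
    have h1 := Γ.avg_const (hd x) 1
    rw [← funext ih, avg_add, avg_sum] at h1
    simp only [avg_const_mul] at h1
    -- Split according to whether the first step lands on `e`.
    have h2 : Γ.avg (Γ.avoid e N) x = Γ.avoid e (N + 1) x + Γ.avoid e N e * Γ.heat 1 x e := by
      rw [avoid, heat, ← avg_const_mul, ← avg_add]
      congr 1
      ext y
      by_cases hy : y = e <;> simp [hy, heat]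
    rw [Finset.sum_range_succ', ← h1, h2]
    simp only [Nat.add_sub_add_right, zero_add, Nat.add_sub_cancel]
    change _ + (∑ j ∈ Finset.range N,
      Γ.avoid e (N - (j + 1)) e * Γ.avg (fun y => Γ.heat (j + 1) y e) x + _) = _
    ring

/-- In the last-visit decomposition from `e` the terms add up to one, and each is a return
probability times an avoidance factor of at least `δ`. -/
theorem sum_heat_le (hd : ∀ x, 0 < Γ.deg x) (e : V) {δ : ℝ} (hδ : 0 < δ)
    (h : ∀ k, δ ≤ Γ.avoid e k e) (N : ℕ) :
    ∑ j ∈ Finset.range N, Γ.heat j e e ≤ 1 / δ := by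
  rw [le_div_iff₀ hδ]
  cases N with
  | zero => simp
  | succ N =>
    have h0 : Γ.heat 0 e e = 1 := by simp [heat]
    rw [Finset.sum_range_succ', h0, add_mul, one_mul, add_comm, Finset.sum_mul]
    refine le_of_le_of_eq ?_ (Γ.avoid_add_sum_heat hd e N e)
    refine add_le_add (h N) (Finset.sum_le_sum fun j _ => ?_)
    rw [mul_comm]
    exact mul_le_mul_of_nonneg_right (h _) (Γ.heat_nonneg _ _ _)

theorem summable_heat_self (hd : ∀ x, 0 < Γ.deg x) (e : V) {δ : ℝ} (hδ : 0 < δ)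
    (h : ∀ k, δ ≤ Γ.avoid e k e) : Summable fun n => Γ.heat n e e :=
  summable_of_sum_range_le (fun n => Γ.heat_nonneg n e e) (Γ.sum_heat_le hd e hδ h)

theorem setOf_avoid_eq (e : V) (n : ℕ) :
    {ω : ℕ → V | ∀ j, 0 < j → j ≤ n → ω j ≠ e} = Preorder.frestrictLe (π := fun _ => V) n ⁻¹'
      {ω : Finset.Iic n → V | ∀ j : Finset.Iic n, 0 < j.1 → ω j ≠ e} := by
  ext ω
  exact ⟨fun h j hj => h j.1 hj (Finset.mem_Iic.1 j.2),
    fun h j hj hjn => h ⟨j, Finset.mem_Iic.2 hjn⟩ hj⟩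

/-! ### Transience of the trajectory law gives summable return probabilities -/

section RandomWalk

variable [MeasurableSpace V] [DiscreteMeasurableSpace V]

theorem lintegral_step {x : V} (hx : (Γ.graph.neighborFinset x).Nonempty) {u : V → ℝ}
    (hu : ∀ y, 0 ≤ u y) :
    ∫⁻ y, ENNReal.ofReal (u y) ∂Γ.stepKernel x = ENNReal.ofReal (Γ.avg u x) := by
  have h1 : Γ.stepKernel x = ∑ y ∈ Γ.graph.neighborFinset x,
      ENNReal.ofReal (Γ.weight x y / Γ.deg x) • Measure.dirac y := by
    classical
    change (Γ.step x).toMeasure = _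
    ext s hs
    rw [PMF.toMeasure_apply _ hs, Measure.finsetSum_apply, step, dif_pos hx,
      tsum_eq_sum (s := Γ.graph.neighborFinset x)]
    · refine Finset.sum_congr rfl fun y _ => ?_
      simp [Set.indicator_apply, hs]
    · intro y hy
      simp [Set.indicator_apply, PMF.ofFinset_apply,
        Γ.weight_eq_zero x y (fun h' => hy ((Γ.graph.mem_neighborFinset x y).2 h'))]
  rw [h1, lintegral_finsetSum_measure, avg, ENNReal.ofReal_sum_of_nonneg
    fun y _ => mul_nonneg (Γ.prob_nonneg x y) (hu y)]
  refine Finset.sum_congr rfl fun y _ => ?_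
  rw [lintegral_smul_measure, lintegral_dirac, ENNReal.ofReal_mul (Γ.prob_nonneg x y), smul_eq_mul]

/-- The Markov property of the random walk. -/
theorem lintegral_walkLaw_succ (hd : ∀ x, 0 < Γ.deg x) (e : V) (n : ℕ)
    {A : Set (Finset.Iic n → V)} (hA : MeasurableSet A) {u : V → ℝ} (hu : ∀ y, 0 ≤ u y) :
    ∫⁻ ω in Preorder.frestrictLe n ⁻¹' A, ENNReal.ofReal (u (ω (n + 1))) ∂Γ.walkLaw e =
      ∫⁻ ω in Preorder.frestrictLe n ⁻¹' A, ENNReal.ofReal (Γ.avg u (ω n)) ∂Γ.walkLaw e := by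
  have hA' : MeasurableSet (Preorder.frestrictLe (π := fun _ => V) n ⁻¹' A) :=
    (Preorder.measurable_frestrictLe n) hA
  have key := Kernel.partialTraj_compProd_eq_map_traj (X := fun _ => V) (κ := Γ.historyKernel)
    (Nat.zero_le n) (x₀ := fun _ => e)
  have hm : Measurable fun v : V => ENNReal.ofReal (u v) := Measurable.of_discrete
  have h1 : ∫⁻ ω in Preorder.frestrictLe n ⁻¹' A, ENNReal.ofReal (u (ω (n + 1))) ∂Γ.walkLaw e =
      ∫⁻ q, A.indicator 1 q.1 * ENNReal.ofReal (u q.2)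
        ∂((Γ.walkLaw e).map fun x => (Preorder.frestrictLe n x, x (n + 1))) := by
    rw [lintegral_map, ← lintegral_indicator hA']
    · refine lintegral_congr fun ω => ?_
      by_cases h : Preorder.frestrictLe n ω ∈ A <;> simp [h]
    · exact ((measurable_one.indicator hA).comp measurable_fst).mul (hm.comp measurable_snd)
    · exact (Preorder.measurable_frestrictLe n).prodMk (measurable_pi_apply _)
  have hf : Measurable fun q : (Finset.Iic n → V) × V =>
      A.indicator 1 q.1 * ENNReal.ofReal (u q.2) :=
    ((measurable_one.indicator hA).comp measurable_fst).mul (hm.comp measurable_snd)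
  rw [h1, walkLaw, ← key, Measure.lintegral_compProd hf,
    ← Kernel.traj_map_frestrictLe_apply, lintegral_map, ← lintegral_indicator hA']
  · refine lintegral_congr fun ω => ?_
    have h2 : ∫⁻ y, ENNReal.ofReal (u y) ∂Γ.historyKernel n (Preorder.frestrictLe n ω) =
        ENNReal.ofReal (Γ.avg u (ω n)) :=
      Γ.lintegral_step (Γ.neighborFinset_nonempty (hd _)) hu
    have h3 : ∫⁻ y, A.indicator 1 (Preorder.frestrictLe (π := fun _ => V) n ω) *
        ENNReal.ofReal (u y) ∂Γ.historyKernel n (Preorder.frestrictLe n ω) = _ :=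
      lintegral_const_mul _ hm
    refine h3.trans ?_
    rw [h2]
    by_cases h : Preorder.frestrictLe n ω ∈ A <;> simp [h]
  · exact Measurable.lintegral_kernel_prod_right' hf
  · exact Preorder.measurable_frestrictLe n

theorem measurableSet_avoid (e : V) (n : ℕ) :
    MeasurableSet {ω : Finset.Iic n → V | ∀ j : Finset.Iic n, 0 < j.1 → ω j ≠ e} := by
  simp only [Set.ofPred_forall]
  refine MeasurableSet.iInter fun j => MeasurableSet.iInter fun _ => ?_
  have hj : Measurable fun ω : Finset.Iic n → V => ω j := measurable_pi_apply j
  exact hj (MeasurableSet.of_discrete (s := {e}ᶜ))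

/-- By induction on `k`: the Markov property trades one averaging step in `avoid` for one more time
in the event. -/
theorem lintegral_avoid (hd : ∀ x, 0 < Γ.deg x) (e : V) (k n : ℕ) :
    ∫⁻ ω in {ω | ∀ j, 0 < j → j ≤ n → ω j ≠ e}, ENNReal.ofReal (Γ.avoid e k (ω n)) ∂Γ.walkLaw e =
      Γ.walkLaw e {ω | ∀ j, 0 < j → j ≤ n + k → ω j ≠ e} := by
  have hB (n : ℕ) : MeasurableSet {ω : ℕ → V | ∀ j, 0 < j → j ≤ n → ω j ≠ e} := by
    rw [setOf_avoid_eq]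
    exact Preorder.measurable_frestrictLe n (measurableSet_avoid e n)
  induction k generalizing n with
  | zero => simp [avoid]
  | succ k ih =>
    classical
    rw [show n + (k + 1) = n + 1 + k by ring, ← ih, setOf_avoid_eq e n, avoid,
      ← Γ.lintegral_walkLaw_succ hd e n (measurableSet_avoid e n), ← setOf_avoid_eq,
      ← lintegral_indicator (hB n), ← lintegral_indicator (hB (n + 1))]
    · refine lintegral_congr fun ω => ?_
      have hiff : (∀ j, 0 < j → j ≤ n + 1 → ω j ≠ e) ↔
          (∀ j, 0 < j → j ≤ n → ω j ≠ e) ∧ ω (n + 1) ≠ e := by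
        refine ⟨fun h => ⟨fun j hj hjn => h j hj (by lia), h _ (by lia) le_rfl⟩,
          fun h j hj hjn => ?_⟩
        rcases Nat.le_succ_iff.1 hjn with h' | rfl
        exacts [h.1 j hj h', h.2]
      simp only [Set.indicator_apply, Set.mem_ofPred_eq, hiff]
      by_cases h1 : ω (n + 1) = e <;> simp [h1]
    · intro y
      split_ifs
      exacts [le_rfl, Γ.avoid_nonneg e k y]

theorem walkLaw_avoid (hd : ∀ x, 0 < Γ.deg x) (e : V) (k : ℕ) :
    Γ.walkLaw e {ω | ∀ j, 0 < j → j ≤ k → ω j ≠ e} = ENNReal.ofReal (Γ.avoid e k e) := by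
  have h := Γ.lintegral_avoid hd e k 0
  rw [zero_add] at h
  have h0 : {ω : ℕ → V | ∀ j, 0 < j → j ≤ 0 → ω j ≠ e} = Set.univ := by
    ext ω
    simp only [Set.mem_ofPred_eq, Set.mem_univ, iff_true]
    intro j hj hj'
    lia
  have hm : Measurable fun v : V => ENNReal.ofReal (Γ.avoid e k v) := Measurable.of_discrete
  rw [← h, h0, Measure.restrict_univ, walkLaw, Kernel.lintegral_traj]
  · simp [Function.updateFinset]
  · exact hm.comp (measurable_pi_apply 0)

/-- The bound `δ` is the probability of never returning, an event contained in every finite-time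
avoidance event. -/
theorem exists_le_avoid (hd : ∀ x, 0 < Γ.deg x) {e : V} (he : Γ.IsTransientAt e) :
    ∃ δ : ℝ, 0 < δ ∧ ∀ k, δ ≤ Γ.avoid e k e := by
  have : IsProbabilityMeasure (Γ.walkLaw e) := by unfold walkLaw; infer_instance
  have hpos : 0 < 1 - Γ.walkLaw e {ω | ∃ n, 0 < n ∧ ω n = e} := tsub_pos_of_lt he
  refine ⟨(1 - Γ.walkLaw e {ω | ∃ n, 0 < n ∧ ω n = e}).toReal,
    ENNReal.toReal_pos hpos.ne' (ne_top_of_le_ne_top ENNReal.one_ne_top tsub_le_self), fun k => ?_⟩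
  refine ENNReal.toReal_le_of_le_ofReal (Γ.avoid_nonneg e k e) ?_
  rw [← Γ.walkLaw_avoid hd e k, tsub_le_iff_right, ← measure_univ (μ := Γ.walkLaw e)]
  refine le_trans (measure_mono fun ω _ => ?_) (measure_union_le _ _)
  by_cases h : ∃ n, 0 < n ∧ ω n = e
  · exact Or.inr h
  · push Not at h
    exact Or.inl fun j hj _ => h j hj

theorem summable_heat_of_isTransientAt (hd : ∀ x, 0 < Γ.deg x) {e : V}
    (he : Γ.IsTransientAt e) : Summable fun n => Γ.heat n e e := by
  obtain ⟨δ, hδ, h⟩ := Γ.exists_le_avoid hd he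
  exact Γ.summable_heat_self hd e hδ h

/-- At an isolated vertex the walk stays where it is, so that the vertex is not transient. -/
theorem deg_pos_of_isTransientAt {e : V} (he : Γ.IsTransientAt e) : 0 < Γ.deg e := by
  by_contra hdeg
  have hne : ¬ (Γ.graph.neighborFinset e).Nonempty := fun h => hdeg (Γ.deg_pos h)
  have hmap : (Γ.walkLaw e).map (fun ω => ω 1) = Measure.dirac e := by
    have h := congrArg (fun κ : Kernel (Finset.Iic 0 → V) V => κ fun _ => e)
      (Kernel.map_traj_succ_self (X := fun _ => V) (κ := Γ.historyKernel) (a := 0))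
    simp only [zero_add] at h
    rw [Kernel.map_apply _ (measurable_pi_apply 1)] at h
    refine h.trans ?_
    change (Γ.step e).toMeasure = _
    rw [step, dif_neg hne, PMF.toMeasure_pure]
  have hev : Measurable fun ω : ℕ → V => ω 1 := measurable_pi_apply 1
  have hs : MeasurableSet ({e} : Set V) := MeasurableSet.of_discrete
  have h1 : Γ.walkLaw e ((fun ω : ℕ → V => ω 1) ⁻¹' {e}) = 1 := by
    rw [← Measure.map_apply hev hs, hmap, Measure.dirac_apply' _ hs]
    simp
  refine absurd he (not_lt.2 ?_)
  rw [← h1]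
  exact measure_mono fun ω hω => ⟨1, one_pos, hω⟩

end RandomWalk

/-! ### Invariance under automorphisms -/

section Automorphisms

theorem weight_smul {V : Type*} (Γ : WeightedGraph V) (g : Γ.aut) (x y : V) : Γ.weight (g • x) (g • y) = Γ.weight x y :=
  (g.2 x y).2

theorem sum_neighborFinset_smul (g : Γ.aut) (x : V) (f : V → ℝ) :
    ∑ y ∈ Γ.graph.neighborFinset (g • x), f y = ∑ y ∈ Γ.graph.neighborFinset x, f (g • y) := by
  symm
  refine Finset.sum_equiv (g : Equiv.Perm V) (fun y => ?_) fun y _ => rfl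
  rw [SimpleGraph.mem_neighborFinset, SimpleGraph.mem_neighborFinset]
  exact (g.2 x y).1.symm

theorem deg_smul (g : Γ.aut) (x : V) : Γ.deg (g • x) = Γ.deg x := by
  simp only [deg, sum_neighborFinset_smul, weight_smul]

theorem avg_smul (g : Γ.aut) (f : V → ℝ) (x : V) :
    Γ.avg f (g • x) = Γ.avg (fun y => f (g • y)) x := by
  simp only [avg, sum_neighborFinset_smul, weight_smul, deg_smul]

theorem heat_smul (g : Γ.aut) (n : ℕ) (x z : V) : Γ.heat n (g • x) (g • z) = Γ.heat n x z := by
  induction n generalizing x with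
  | zero =>
    classical
    exact if_congr (smul_left_cancel_iff g) rfl rfl
  | succ n ih => simp only [heat, avg_smul, ih]

variable {Γ}

theorem IsVertexTransitive.deg_eq (hΓ : Γ.IsVertexTransitive) (x y : V) : Γ.deg x = Γ.deg y := by
  obtain ⟨g, rfl⟩ := hΓ x y
  exact (Γ.deg_smul g x).symm

theorem IsVertexTransitive.heat_self (hΓ : Γ.IsVertexTransitive) (n : ℕ) (x y : V) :
    Γ.heat n x x = Γ.heat n y y := by
  obtain ⟨g, rfl⟩ := hΓ x y
  exact (Γ.heat_smul g n x x).symm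

end Automorphisms

/-! ### Symmetry and on-diagonal bounds for the heat kernel -/

section HeatKernel

theorem finite_heat_ne_zero (n : ℕ) (x : V) : {z | Γ.heat n x z ≠ 0}.Finite := by
  induction n generalizing x with
  | zero =>
    refine (Set.finite_singleton x).subset fun z hz => ?_
    by_contra h
    exact hz (by simp [heat, show x ≠ z from fun h' => h h'.symm])
  | succ n ih =>
    refine ((Γ.graph.neighborFinset x).finite_toSet.biUnion fun y _ => ih y).subset fun z hz => ?_
    obtain ⟨y, hy, hne⟩ := Finset.exists_ne_zero_of_sum_ne_zero hz
    exact Set.mem_biUnion hy (right_ne_zero_of_mul hne)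

theorem summable_heat_mul (n : ℕ) (x : V) (f : V → ℝ) : Summable fun w => Γ.heat n x w * f w :=
  summable_of_hasFiniteSupport
    ((Γ.finite_heat_ne_zero n x).subset fun _ hw => left_ne_zero_of_mul hw)

/-- The Chapman-Kolmogorov equation. -/
theorem heat_add (m n : ℕ) (x z : V) :
    Γ.heat (m + n) x z = ∑' w, Γ.heat m x w * Γ.heat n w z := by
  induction m generalizing x with
  | zero =>
    rw [tsum_eq_single x]
    · simp [heat]
    · intro w hw
      simp [heat, hw.symm]
  | succ m ih =>
    rw [show m + 1 + n = m + n + 1 by ring]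
    simp only [heat, avg, ih, Finset.sum_mul, ← tsum_mul_left]
    rw [← Summable.tsum_finsetSum]
    · simp only [mul_assoc]
    · exact fun y _ => (Γ.summable_heat_mul m y _).mul_left _

variable {Γ}

/-- Constant degree makes the one-step kernel symmetric, and its powers inherit this. -/
theorem heat_comm (hdeg : ∀ x y, Γ.deg x = Γ.deg y) (n : ℕ) (x z : V) :
    Γ.heat n x z = Γ.heat n z x := by
  have h1 (x z : V) : Γ.heat 1 x z = Γ.weight x z / Γ.deg x := by
    classical
    simp only [heat, avg, mul_ite, mul_one, mul_zero, Finset.sum_ite_eq',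
      SimpleGraph.mem_neighborFinset]
    split_ifs with h
    · rfl
    · rw [Γ.weight_eq_zero x z h, zero_div]
  have h1' (x z : V) : Γ.heat 1 x z = Γ.heat 1 z x := by
    rw [h1, h1, Γ.weight_symm x z, hdeg x z]
  induction n generalizing x z with
  | zero =>
    classical
    exact if_congr eq_comm rfl rfl
  | succ n ih =>
    rw [heat_add, add_comm n 1, heat_add]
    refine tsum_congr fun w => ?_
    rw [ih, h1' w z, mul_comm]

/-- Sum `(p_n(x,w) - p_n(y,w))² ≥ 0` over `w`, where `p_n` is `heat n`; symmetry turns the sums into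
time-`2n` kernels, and transitivity equates the diagonal terms. -/
theorem heat_two_mul_le (hΓ : Γ.IsVertexTransitive) (n : ℕ) (x y e : V) :
    Γ.heat (2 * n) x y ≤ Γ.heat (2 * n) e e := by
  have key (x y : V) : HasSum (fun w => Γ.heat n x w * Γ.heat n y w) (Γ.heat (2 * n) x y) := by
    rw [two_mul, heat_add]
    simp only [heat_comm hΓ.deg_eq n _ y]
    exact (Γ.summable_heat_mul n x _).hasSum
  have h := ((key x x).add (key y y)).sub ((key x y).mul_left 2)
  have h0 := h.nonneg fun w => by nlinarith [sq_nonneg (Γ.heat n x w - Γ.heat n y w)]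
  rw [hΓ.heat_self _ x e, hΓ.heat_self _ y e] at h0
  linarith

theorem heat_le (hΓ : Γ.IsVertexTransitive) (hd : ∀ x, 0 < Γ.deg x) (n : ℕ) (x y e : V) :
    Γ.heat n x y ≤ Γ.heat (2 * (n / 2)) e e := by
  rcases Nat.even_or_odd' n with ⟨k, rfl | rfl⟩
  · rw [Nat.mul_div_cancel_left k two_pos]
    exact heat_two_mul_le hΓ k x y e
  -- At odd times the kernel is an average of even-time kernels.
  · rw [show (2 * k + 1) / 2 = k by lia, ← Γ.avg_const (hd x) (Γ.heat (2 * k) e e)]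
    exact Γ.avg_mono (fun w => heat_two_mul_le hΓ k w y e) x

theorem summable_heat_bound {e : V} (hs : Summable fun n => Γ.heat n e e) :
    Summable fun n => Γ.heat (2 * (n / 2)) e e := by
  have h : Summable fun k => Γ.heat (2 * k) e e :=
    hs.comp_injective (i := fun k => 2 * k) fun a b hab => by simpa using hab
  refine (HasSum.even_add_odd (m := ∑' k, Γ.heat (2 * k) e e) (m' := ∑' k, Γ.heat (2 * k) e e)
    ?_ ?_).summable
  · convert h.hasSum using 5
    lia
  · convert h.hasSum using 5
    lia

theorem summable_heat (hΓ : Γ.IsVertexTransitive) (hd : ∀ x, 0 < Γ.deg x) {e : V}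
    (hs : Summable fun n => Γ.heat n e e) (x y : V) : Summable fun n => Γ.heat n x y :=
  (summable_heat_bound hs).of_nonneg_of_le (fun n => Γ.heat_nonneg n x y)
    fun n => heat_le hΓ hd n x y e

end HeatKernel

/-! ### The Green function -/

section Green

/-- The Green function: the expected number of visits to `z` of the walk started at `x`. -/
noncomputable def green (x z : V) : ℝ := ∑' n, Γ.heat n x z

theorem green_smul (g : Γ.aut) (x z : V) : Γ.green (g • x) (g • z) = Γ.green x z := by
  simp only [green, heat_smul]

theorem green_nonneg (x z : V) : 0 ≤ Γ.green x z := tsum_nonneg fun n => Γ.heat_nonneg n x z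

variable {Γ}

theorem green_comm (hdeg : ∀ x y, Γ.deg x = Γ.deg y) (x z : V) : Γ.green x z = Γ.green z x := by
  simp only [green, heat_comm hdeg _ x z]

open Classical in
theorem green_eq (hs : ∀ x z, Summable fun n => Γ.heat n x z) (x z : V) :
    Γ.green x z = (if x = z then 1 else 0) + Γ.avg (fun y => Γ.green y z) x := by
  rw [green, (hs x z).tsum_eq_zero_add]
  simp only [heat, avg, green, ← tsum_mul_left]
  rw [Summable.tsum_finsetSum fun y _ => (hs y z).mul_left _]

theorem green_self_pos (hs : ∀ x z, Summable fun n => Γ.heat n x z) (x : V) :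
    0 < Γ.green x x := by
  rw [green_eq hs, if_pos rfl]
  exact add_pos_of_pos_of_nonneg one_pos (Γ.avg_nonneg (fun y => Γ.green_nonneg y x) x)

theorem green_pos_of_adj (hs : ∀ x z, Summable fun n => Γ.heat n x z) (hd : ∀ x, 0 < Γ.deg x)
    {x y z : V} (h : Γ.graph.Adj x y) (hy : 0 < Γ.green y z) : 0 < Γ.green x z := by
  classical
  rw [green_eq hs]
  refine add_pos_of_nonneg_of_pos (by split_ifs <;> norm_num) ?_
  refine Finset.sum_pos' (fun w _ => mul_nonneg (Γ.prob_nonneg x w) (Γ.green_nonneg w z))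
    ⟨y, (Γ.graph.mem_neighborFinset x y).2 h, ?_⟩
  exact mul_pos (div_pos (Γ.weight_pos x y h) (hd x)) hy

/-- The Green function tends to zero at infinity. -/
theorem tendsto_green (hΓ : Γ.IsVertexTransitive) (hd : ∀ x, 0 < Γ.deg x) {e : V}
    (hs : Summable fun n => Γ.heat n e e) (x : V) :
    Filter.Tendsto (Γ.green x) Filter.cofinite (nhds 0) := by
  have h := tendsto_tsum_of_dominated_convergence (𝓕 := Filter.cofinite)
    (f := fun z n => Γ.heat n x z) (g := fun _ => (0 : ℝ)) (summable_heat_bound hs)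
    (fun n => Filter.Tendsto.congr' (f₁ := fun _ => 0) ?_ tendsto_const_nhds)
    (Filter.Eventually.of_forall fun z n => ?_)
  · rwa [tsum_zero] at h
  · filter_upwards [(Γ.finite_heat_ne_zero n x).compl_mem_cofinite] with z hz
    exact (not_not.1 hz).symm
  · rw [Real.norm_of_nonneg (Γ.heat_nonneg n x z)]
    exact heat_le hΓ hd n x z e

open Classical in
/-- The vertices from which `e` can be reached: their indicator is a harmonic function. -/
theorem isHarmonic_indicator_green_pos (hs : ∀ x z, Summable fun n => Γ.heat n x z)
    (hd : ∀ x, 0 < Γ.deg x) (e : V) :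
    Γ.IsHarmonic fun x => if 0 < Γ.green x e then 1 else 0 := by
  intro x
  rw [laplacian_eq, sub_eq_zero]
  refine (Γ.avg_const (hd x) _).symm.trans (Finset.sum_congr rfl fun y hy => ?_)
  have hxy := (Γ.graph.mem_neighborFinset x y).1 hy
  have hiff : 0 < Γ.green x e ↔ 0 < Γ.green y e :=
    ⟨green_pos_of_adj hs hd hxy.symm, green_pos_of_adj hs hd hxy⟩
  simp only [hiff]

end Green

/-! ### Duality between harmonic functions and finitely supported functions -/

/-- If no harmonic function separates `x` and `y`, then the difference of the point evaluations
at `x` and `y` is a finite linear combination of evaluations of the Laplacian. -/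
theorem exists_finsupp_of_forall_isHarmonic {x y : V}
    (h : ∀ u, Γ.IsHarmonic u → u x = u y) :
    ∃ φ : V →₀ ℝ, ∀ u : V → ℝ, u x - u y = φ.sum fun v a => a * Γ.laplacian u v := by
  let D : V → V →₀ ℝ := fun v => Finsupp.single v 1 -
    ∑ w ∈ Γ.graph.neighborFinset v, Finsupp.single w (Γ.weight v w / Γ.deg v)
  have hD (f : (V →₀ ℝ) →ₗ[ℝ] ℝ) (v : V) :
      f (D v) = Γ.laplacian (fun w => f (Finsupp.single w 1)) v := by
    rw [laplacian_eq, map_sub, map_sum, avg]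
    congr 1
    refine Finset.sum_congr rfl fun w _ => ?_
    rw [← smul_eq_mul, ← map_smul, Finsupp.smul_single, smul_eq_mul, mul_one]
  have hmem : (Finsupp.single x 1 - Finsupp.single y 1 : V →₀ ℝ) ∈
      LinearMap.range (Finsupp.linearCombination ℝ D) := by
    by_contra hne
    -- A linear functional on `V →₀ ℝ` amounts to a function on `V`; killing every `D v` means that
    -- this function is harmonic.
    obtain ⟨f, hf, hker⟩ := Submodule.exists_le_ker_of_notMem hne
    refine hf ?_
    rw [map_sub, sub_eq_zero]
    refine h (fun w => f (Finsupp.single w 1)) fun v => ?_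
    rw [← hD]
    exact hker ⟨Finsupp.single v 1, by simp⟩
  obtain ⟨φ, hφ⟩ := hmem
  refine ⟨φ, fun u => ?_⟩
  have h1 := congrArg (Finsupp.linearCombination ℝ u) hφ
  rw [Finsupp.linearCombination_apply ℝ φ, map_finsuppSum, map_sub] at h1
  simp only [map_smul, hD, Finsupp.linearCombination_single, smul_eq_mul, one_mul] at h1
  exact h1.symm

variable {Γ}

theorem finite_green_ne (hs : ∀ x z, Summable fun n => Γ.heat n x z) {x y : V}
    (h : ∀ u, Γ.IsHarmonic u → u x = u y) : {z | Γ.green x z ≠ Γ.green y z}.Finite := by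
  classical
  obtain ⟨φ, hφ⟩ := Γ.exists_finsupp_of_forall_isHarmonic h
  refine φ.hasFiniteSupport.subset fun z hz => ?_
  have h1 := hφ fun v => Γ.green v z
  have h2 (v : V) : Γ.laplacian (fun v => Γ.green v z) v = if v = z then 1 else 0 := by
    rw [laplacian_eq, green_eq hs v z, add_sub_cancel_right]
  simp only [h2, mul_ite, mul_one, mul_zero] at h1
  rw [Finsupp.sum_ite_self_eq'] at h1
  exact fun h0 => sub_ne_zero.2 hz (h1.trans h0)

end WeightedGraph

theorem mainTheorem9 {V : Type*} [MeasurableSpace V] [DiscreteMeasurableSpace V]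
    (Γ : WeightedGraph V) [Γ.graph.LocallyFinite] (hΓ : Γ.IsVertexTransitive)
    (e : V) (htransient : Γ.IsTransientAt e)
    (K : Subgroup Γ.aut) (hKfg : K.FG) (hKe : (MulAction.orbit K e).Infinite) :
    ∃ h : V → ℝ, Γ.IsHarmonic h ∧
      ∃ x ∈ MulAction.orbit K e, ∃ y ∈ MulAction.orbit K e, h x ≠ h y := by
  by_contra! hconst
  have hd (x : V) : 0 < Γ.deg x := hΓ.deg_eq e x ▸ Γ.deg_pos_of_isTransientAt htransient
  have hse := Γ.summable_heat_of_isTransientAt hd htransient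
  have hs := WeightedGraph.summable_heat hΓ hd hse
  have heK : e ∈ MulAction.orbit K e := MulAction.mem_orbit_self e
  obtain ⟨S, rfl, hSfin⟩ := (Subgroup.fg_iff K).1 hKfg
  refine not_tendsto_of_finite_ne hSfin hKe (fun x hx => ?_) (fun s hsS => ?_)
    (WeightedGraph.tendsto_green hΓ hd hse e)
  · classical
    -- Connectedness is not available, so positivity on the orbit also comes from the contradiction
    -- hypothesis, applied to this harmonic indicator.
    have h := hconst _ (WeightedGraph.isHarmonic_indicator_green_pos hs hd e) x hx e heK
    rw [if_pos (WeightedGraph.green_self_pos hs e)] at h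
    rw [WeightedGraph.green_comm hΓ.deg_eq]
    by_contra hx0
    rw [if_neg hx0] at h
    exact zero_ne_one h
  · have hmem : s⁻¹ • e ∈ MulAction.orbit (Subgroup.closure S) e :=
      ⟨⟨s⁻¹, inv_mem (Subgroup.subset_closure hsS)⟩, rfl⟩
    refine (WeightedGraph.finite_green_ne hs fun u hu => hconst u hu _ hmem _ heK).subset ?_
    intro z hz
    -- Invariance gives `G(s⁻¹e, z) = G(e, sz)`.
    rw [Set.mem_ofPred_eq, ← Γ.green_smul s, smul_inv_smul]
    exact hz
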